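/- Let $\omega=\{0,1,2,\dots\}$, and let $\mathbb{R}^+=[0,\infty)$. For relations $E$ on $X$ and $F$ on $Y$ ($X,Y$ Polish spaces) write $E\le_B F$ if there is a Borel map $\theta:X\to Y$ with $x\,E\,x'\Leftrightarrow\theta(x)\,F\,\theta(x')$ for all $x,x'\in X$. For $1\le p<\infty$, $\mathbb{R}^\omega/\ell_p$ denotes the equivalence relation on $\mathbb{R}^\omega$ that relates $x$ and $y$ iff $x-y\in\ell_p$. For $f:[0,1]\to\mathbb{R}^+$, $\mathbf{E}_f$ denotes the relation on $[0,1]^\omega$ given by $(x_n)\,\mathbf{E}_f\,(y_n)\Leftrightarrow\sum_{n<\omega}f(|y_n-x_n|)<\infty$. Set $a_0=0$, $a_l=a_{l-1}+1+(l-1)a_{l-1}$ for $l>0$, and $I_l=[a_l,a_{l+1})\cap\omega$. Let $(\delta_m)_{m<\omega}$ be a sequence in $(0,1)$ with $0<\inf_m\delta_m\le\sup_m\delta_m<1$, and let $(k_m)_{m<\omega}$ be an increasing sequence of integers $\ge 2$ with $k_{m+1}\ge 2k_m$ for all $m$. For $U\subseteq\omega$ let $u_U(0)=1$ and, for $n>0$,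 $$u_U(n)=\begin{cases}\delta_m\,u_U(n-1), & \text{if } n=k_m \text{ with } m\in I_l \text{ for some } l\in U,\\ u_U(n-1), & \text{otherwise.}\end{cases}$$ Let $\alpha\ge 1$ and $U\subseteq\omega$, let $\varphi_U:[0,1]\to\mathbb{R}^+$ be any continuous (weakly) increasing function with $\varphi_U(1/2^n)=u_U(n)$ for all $n<\omega$, and set $f_U(x)=x^\alpha\varphi_U(x)$ for $x\in[0,1]$. Then $\mathbf{E}_{f_U}$ is an equivalence relation, and for every real $\beta>\alpha$, $$\mathbb{R}^\omega/\ell_\alpha\ \le_B\ \mathbf{E}_{f_U}\ \le_B\ \mathbb{R}^\omega/\ell_\beta .$$ -/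

import Mathlib

open scoped NNReal ENNReal unitInterval

noncomputable section

namespace EfBetween

/-- Borel reducibility `E ≤_B F` of relations on Borel spaces: there is a Borel map `θ` with
`E x x' ↔ F (θ x) (θ x')`. -/
def BorelReducible {X Y : Type*} [TopologicalSpace X] [MeasurableSpace X] [BorelSpace X]
    [TopologicalSpace Y] [MeasurableSpace Y] [BorelSpace Y]
    (E : X → X → Prop) (F : Y → Y → Prop) : Prop :=
  ∃ θ : X → Y, Measurable θ ∧ ∀ x x' : X, E x x' ↔ F (θ x) (θ x')

/-- The relation `ℝ^ω / ℓ_p` on `ℝ^ω`: the difference of the two sequences lies in `ℓ_p`. -/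
def lpRel (p : ℝ) (x y : ℕ → ℝ) : Prop :=
  Memℓp (x - y) (ENNReal.ofReal p)

/-- The distance `|y - x|` of two points of `[0,1]`, as a point of `[0,1]`. -/
def absDiff (x y : I) : I :=
  ⟨|(y : ℝ) - x|, abs_nonneg _, abs_le.2 ⟨by linarith [x.2.2, y.2.1], by linarith [x.2.1, y.2.2]⟩⟩

/-- The relation `𝐄_f` on `[0,1]^ω`: `∑ f(|y_n - x_n|) < ∞`. -/
def Ef (f : I → ℝ≥0) (x y : ℕ → I) : Prop :=
  Summable fun n => f (absDiff (x n) (y n))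

/-- `a_0 = 0` and `a_l = a_{l-1} + 1 + (l-1) a_{l-1}` for `l > 0`. -/
def a : ℕ → ℕ
  | 0 => 0
  | l + 1 => a l + 1 + l * a l

/-- The block `I_l = [a_l, a_{l+1}) ∩ ω`. -/
def block (l : ℕ) : Set ℕ := Set.Ico (a l) (a (l + 1))

open scoped Classical in
/-- The sequence `u_U`: `u_U(0) = 1`, and for `n > 0` one has `u_U(n) = δ_m u_U(n-1)` if `n = k_m`
with `m ∈ I_l` for some `l ∈ U`, and `u_U(n) = u_U(n-1)` otherwise. The `m` chosen here is
unique as `k` is injective wherever this definition is used. -/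
def uSeq (δ : ℕ → ℝ) (k : ℕ → ℕ) (U : Set ℕ) : ℕ → ℝ
  | 0 => 1
  | n + 1 =>
    if h : ∃ m, n + 1 = k m ∧ ∃ l ∈ U, m ∈ block l then
      δ h.choose * uSeq δ k U n
    else uSeq δ k U n

/-- The point `1/2^n` of `[0,1]`. -/
def dyadic (n : ℕ) : I :=
  ⟨1 / 2 ^ n, by positivity, by
    rw [div_le_one (by positivity)]
    exact one_le_pow₀ (by norm_num)⟩

/-- The function `x ↦ x^α φ(x)` on `[0,1]`. -/
def powMul (α : ℝ) (φ : I → ℝ≥0) (x : I) : ℝ≥0 :=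
  unitInterval.toNNReal x ^ α * φ x

end EfBetween

end

noncomputable section

namespace EfBetween

/-! ### Sparse drops of `u` -/

section USeq

variable {δ : ℕ → ℝ} {k : ℕ → ℕ} {U : Set ℕ}

/-! Put `F(x) = x^α φ(x)`, `r = 2^{-α}`, `d = inf δ`; then `F(2^{-n}) = r^n u(n)`, and `u` is
nonincreasing, losing at most a factor `d` per step and only at the positions `k m`. These at least
double, so `u` has long plateaus (`exists_uSeq_const`) and decays at most polynomially
(`exists_uSeq_le_pow_mul`).

Since `F(2^{-n-1}) ≥ r d F(2^{-n})`, `F` is doubling, whence transitivity.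

For the lower reduction, a plateau makes `F` a multiple `v` of the power `α` on a window `[2^{-n-i},
2^{-n}]`. The `i`-th real is rounded to the grid `2^{-i}ℤ`, an `ℓ_α` error, spread over `[0,1]^ℤ`,
and scaled by `2^{-n}`: every nonzero difference falls in the window. About `1/v` copies cancel the
factor `v`.

For the upper reduction, `x` is sent to the vectors `F(2^{-n})^{1/β} (cos 2^n x, sin 2^n x)`. If `|x
- y|` is about `2^{-N}`, the `N`-th vector alone contributes about `F(|x - y|)` to the `β`-th power
of the distance. Scales `n > N` decay like `r^{n-N}`; scales `n < N` like a polynomial in `N - n`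
times `2^{-(β-α)(N-n)}`, summable as `β > α`. -/

lemma uSeq_succ_cases (n : ℕ) :
    (∃ m, n + 1 = k m ∧ uSeq δ k U (n + 1) = δ m * uSeq δ k U n) ∨
      uSeq δ k U (n + 1) = uSeq δ k U n := by
  classical
  by_cases h : ∃ m, n + 1 = k m ∧ ∃ l ∈ U, m ∈ block l
  · left
    refine ⟨h.choose, h.choose_spec.1, ?_⟩
    rw [uSeq, dif_pos h]
  · right
    rw [uSeq, dif_neg h]

lemma uSeq_pos (hδ : ∀ m, δ m ∈ Set.Ioo (0 : ℝ) 1) (n : ℕ) : 0 < uSeq δ k U n := by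
  induction n with
  | zero => rw [uSeq]; exact one_pos
  | succ n ih =>
    rcases uSeq_succ_cases (δ := δ) (k := k) (U := U) n with ⟨m, -, h⟩ | h
    · rw [h]; exact mul_pos (hδ m).1 ih
    · rwa [h]

lemma uSeq_succ_le (hδ : ∀ m, δ m ∈ Set.Ioo (0 : ℝ) 1) (n : ℕ) :
    uSeq δ k U (n + 1) ≤ uSeq δ k U n := by
  rcases uSeq_succ_cases (δ := δ) (k := k) (U := U) n with ⟨m, -, h⟩ | h
  · rw [h]; exact mul_le_of_le_one_left (uSeq_pos hδ n).le (hδ m).2.le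
  · exact h.le

lemma uSeq_antitone (hδ : ∀ m, δ m ∈ Set.Ioo (0 : ℝ) 1) : Antitone (uSeq δ k U) :=
  antitone_nat_of_succ_le (uSeq_succ_le hδ)

lemma mul_uSeq_le_succ (hδ : ∀ m, δ m ∈ Set.Ioo (0 : ℝ) 1) {d : ℝ} (hd1 : d ≤ 1)
    (hd : ∀ m, d ≤ δ m) (n : ℕ) : d * uSeq δ k U n ≤ uSeq δ k U (n + 1) := by
  rcases uSeq_succ_cases (δ := δ) (k := k) (U := U) n with ⟨m, -, h⟩ | h
  · rw [h]; exact mul_le_mul_of_nonneg_right (hd m) (uSeq_pos hδ n).le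
  · rw [h]; exact mul_le_of_le_one_left (uSeq_pos hδ n).le hd1

lemma uSeq_succ_eq {n : ℕ} (hn : ∀ m, n + 1 ≠ k m) : uSeq δ k U (n + 1) = uSeq δ k U n := by
  rcases uSeq_succ_cases (δ := δ) (k := k) (U := U) n with ⟨m, h, -⟩ | h
  · exact absurd h (hn m)
  · exact h

/-- `uSeq` is constant on arbitrarily long intervals. -/
lemma exists_uSeq_const (hk_mono : StrictMono k) (hk_double : ∀ m, 2 * k m ≤ k (m + 1))
    (i : ℕ) : ∃ n, ∀ j ≤ i, uSeq δ k U (n + j) = uSeq δ k U n := by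
  -- The next drop is at distance at least `k (i + 1) ≥ i + 1`.
  refine ⟨k (i + 1), fun j => ?_⟩
  induction j with
  | zero => intro _; rfl
  | succ j ih =>
    intro hj
    rw [← ih (by omega), ← add_assoc]
    refine uSeq_succ_eq fun m hm => ?_
    have h1 : i + 1 ≤ k (i + 1) := hk_mono.le_apply
    have h2 := hk_double (i + 1)
    have h3 : i + 1 < m := hk_mono.lt_iff_lt.1 (by omega)
    have h4 : k (i + 1 + 1) ≤ k m := hk_mono.monotone h3
    omega

lemma two_pow_mul_le (hk_double : ∀ m, 2 * k m ≤ k (m + 1)) (m j : ℕ) :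
    2 ^ j * k m ≤ k (m + j) := by
  induction j with
  | zero => simp
  | succ j ih =>
    have := hk_double (m + j)
    rw [pow_succ, ← add_assoc]
    nlinarith

/-- The number of indices `m` with `k m ∈ (n, N]` is logarithmic in `N - n`. -/
lemma two_pow_card_le (hk_two : ∀ m, 2 ≤ k m)
    (hk_double : ∀ m, 2 * k m ≤ k (m + 1)) (n j : ℕ) (M : Finset ℕ)
    (hM : ∀ m ∈ M, n < k m ∧ k m ≤ n + j) : 2 ^ M.card ≤ 2 * (j + 1) := by
  rcases M.eq_empty_or_nonempty with rfl | hne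
  · rw [Finset.card_empty]
    omega
  · set p := M.min' hne
    set q := M.max' hne
    have hpq : p ≤ q := Finset.min'_le _ _ (M.max'_mem hne)
    have hsub : M ⊆ Finset.Icc p q := fun m hm =>
      Finset.mem_Icc.2 ⟨M.min'_le m hm, M.le_max' m hm⟩
    have hcard : M.card ≤ (q - p) + 1 := by
      have := Finset.card_le_card hsub
      rw [Nat.card_Icc] at this
      omega
    have h1 := two_pow_mul_le hk_double p (q - p)
    rw [Nat.add_sub_cancel' hpq] at h1
    have h2 := hM p (M.min'_mem hne)
    have h3 := hM q (M.max'_mem hne)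
    have h4 : 2 ^ M.card ≤ 2 ^ ((q - p) + 1) := Nat.pow_le_pow_right (by norm_num) hcard
    rw [pow_succ] at h4
    have h5 := hk_two p
    have h6 : 1 ≤ 2 ^ (q - p) := Nat.one_le_two_pow
    -- From `2^(q-p) * k p ≤ n + j < k p + j`, so `(2^(q-p) - 1) * k p < j`.
    have h7 : 2 ^ (q - p) ≤ j + 1 := by
      obtain ⟨r, hr⟩ := Nat.exists_eq_add_of_le h6
      rw [hr] at h1 ⊢
      nlinarith
    omega

/-- One factor `d⁻¹` is paid for each `k m` crossed. The range loses no index because `m ≤ k m`. -/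
lemma uSeq_le_inv_pow_card (hδ : ∀ m, δ m ∈ Set.Ioo (0 : ℝ) 1) {d : ℝ} (hd0 : 0 < d)
    (hd : ∀ m, d ≤ δ m) (hk_mono : StrictMono k) (n j : ℕ) :
    uSeq δ k U n ≤ d⁻¹ ^ ((Finset.range (n + j + 1)).filter
      fun m => n < k m ∧ k m ≤ n + j).card * uSeq δ k U (n + j) := by
  have hd1 : d ≤ 1 := (hd 0).trans (hδ 0).2.le
  have hinv : 1 ≤ d⁻¹ := (one_le_inv₀ hd0).2 hd1
  induction j with
  | zero => exact le_mul_of_one_le_left (uSeq_pos hδ n).le (one_le_pow₀ hinv)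
  | succ j ih =>
    refine ih.trans ?_
    have hsub : ((Finset.range (n + j + 1)).filter fun m => n < k m ∧ k m ≤ n + j) ⊆
        (Finset.range (n + (j + 1) + 1)).filter fun m => n < k m ∧ k m ≤ n + (j + 1) := by
      intro m
      simp only [Finset.mem_filter, Finset.mem_range]
      omega
    by_cases h : ∃ m, n + j + 1 = k m
    · obtain ⟨m, hm⟩ := h
      have hlt : ((Finset.range (n + j + 1)).filter fun m => n < k m ∧ k m ≤ n + j).card <
          ((Finset.range (n + (j + 1) + 1)).filter
            fun m => n < k m ∧ k m ≤ n + (j + 1)).card := by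
        refine Finset.card_lt_card ((Finset.ssubset_iff_of_subset hsub).2 ⟨m, ?_, ?_⟩)
        · have : m ≤ k m := hk_mono.le_apply
          simp only [Finset.mem_filter, Finset.mem_range]
          omega
        · simp only [Finset.mem_filter, Finset.mem_range]
          omega
      have h1 : uSeq δ k U (n + j) ≤ d⁻¹ * uSeq δ k U (n + j + 1) := by
        rw [← div_eq_inv_mul, le_div_iff₀ hd0, mul_comm]
        exact mul_uSeq_le_succ hδ hd1 hd _
      refine (mul_le_mul_of_nonneg_left h1 (by positivity)).trans ?_
      rw [← mul_assoc, ← pow_succ]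
      exact mul_le_mul_of_nonneg_right (pow_le_pow_right₀ hinv hlt) (uSeq_pos hδ _).le
    · push Not at h
      rw [← add_assoc n j 1, uSeq_succ_eq h]
      exact mul_le_mul_of_nonneg_right (pow_le_pow_right₀ hinv (Finset.card_le_card hsub))
        (uSeq_pos hδ _).le

/-- `uSeq` decays at most polynomially, uniformly in the starting point. -/
lemma exists_uSeq_le_pow_mul (hδ : ∀ m, δ m ∈ Set.Ioo (0 : ℝ) 1) {d : ℝ} (hd0 : 0 < d)
    (hd : ∀ m, d ≤ δ m) (hk_mono : StrictMono k) (hk_two : ∀ m, 2 ≤ k m)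
    (hk_double : ∀ m, 2 * k m ≤ k (m + 1)) :
    ∃ L : ℕ, ∀ n j : ℕ,
      uSeq δ k U n ≤ (2 * ((j : ℝ) + 1)) ^ L * uSeq δ k U (n + j) := by
  -- With `d⁻¹ < 2^L`, a power of `d⁻¹` with logarithmic exponent becomes a polynomial of degree
  -- `L`.
  obtain ⟨L, hL⟩ := pow_unbounded_of_one_lt d⁻¹ (one_lt_two (α := ℝ))
  refine ⟨L, fun n j => (uSeq_le_inv_pow_card hδ hd0 hd hk_mono n j).trans ?_⟩
  refine mul_le_mul_of_nonneg_right ?_ (uSeq_pos hδ _).le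
  set M := (Finset.range (n + j + 1)).filter fun m => n < k m ∧ k m ≤ n + j
  have hc : (2 : ℝ) ^ M.card ≤ 2 * ((j : ℝ) + 1) := by
    exact_mod_cast two_pow_card_le hk_two hk_double n j M
      fun m hm => (Finset.mem_filter.1 hm).2
  calc d⁻¹ ^ M.card ≤ (2 ^ L) ^ M.card := by gcongr
    _ = (2 ^ M.card) ^ L := by rw [← pow_mul, ← pow_mul, mul_comm]
    _ ≤ _ := by gcongr

end USeq

/-! ### Doubling and the equivalence relation -/

section Doubling

lemma coe_absDiff (x y : I) : (absDiff x y : ℝ) = |(x : ℝ) - y| := abs_sub_comm _ _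

lemma coe_dyadic (n : ℕ) : (dyadic n : ℝ) = (1 / 2) ^ n := by
  rw [one_div_pow]; rfl

lemma absDiff_self (x : I) : absDiff x x = 0 := by
  ext; simp [absDiff]

lemma absDiff_comm (x y : I) : absDiff x y = absDiff y x := by
  ext; rw [coe_absDiff, coe_absDiff, abs_sub_comm]

lemma exists_dyadic_lt_le {t : I} (ht : 0 < (t : ℝ)) :
    ∃ N, dyadic (N + 1) < t ∧ t ≤ dyadic N := by
  obtain ⟨N, h1, h2⟩ := exists_nat_pow_near_of_lt_one ht t.2.2
    (by norm_num : (0 : ℝ) < 1 / 2) (by norm_num)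
  refine ⟨N, ?_, ?_⟩
  · rwa [← Subtype.coe_lt_coe, coe_dyadic]
  · rwa [← Subtype.coe_le_coe, coe_dyadic]

variable {F : I → ℝ≥0} {c : ℝ≥0}

/-- If `2^{-N-1} < t ≤ 2^{-N}`, then `s` is at most `2^{-N+1}`: two dyadic steps, hence `c ^ 2`. For
`N = 0` the bound `s ≤ 1` saves a step. -/
lemma doubling (hF : Monotone F) (hF0 : F 0 = 0) (hc1 : c ≤ 1)
    (hc : ∀ n, c * F (dyadic n) ≤ F (dyadic (n + 1))) {s t : I} (hst : (s : ℝ) ≤ 2 * t) :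
    c ^ 2 * F s ≤ F t := by
  rcases t.2.1.eq_or_lt with ht | ht
  · have : s = 0 := by
      ext
      rw [← ht] at hst
      exact le_antisymm (by simpa using hst) s.2.1
    simp [this, hF0]
  obtain ⟨N, h1, h2⟩ := exists_dyadic_lt_le ht
  rcases N with - | N
  · have hs : s ≤ dyadic 0 := by
      rw [← Subtype.coe_le_coe, coe_dyadic, pow_zero]; exact s.2.2
    calc c ^ 2 * F s ≤ c * F (dyadic 0) :=
          mul_le_mul' (by rw [sq]; exact mul_le_of_le_one_left' hc1) (hF hs)
      _ ≤ F (dyadic 1) := hc 0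
      _ ≤ F t := hF h1.le
  · have hs : s ≤ dyadic N := by
      rw [← Subtype.coe_le_coe, coe_dyadic] at h2 ⊢
      rw [pow_succ] at h2
      linarith
    calc c ^ 2 * F s ≤ c ^ 2 * F (dyadic N) := mul_le_mul' le_rfl (hF hs)
      _ = c * (c * F (dyadic N)) := by ring
      _ ≤ c * F (dyadic (N + 1)) := mul_le_mul' le_rfl (hc N)
      _ ≤ F (dyadic (N + 1 + 1)) := hc _
      _ ≤ F t := hF h1.le

lemma Ef_equivalence (hF : Monotone F) (hF0 : F 0 = 0) (hc0 : 0 < c) (hc1 : c ≤ 1)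
    (hc : ∀ n, c * F (dyadic n) ≤ F (dyadic (n + 1))) : Equivalence (Ef F) where
  refl x := by
    simp only [Ef, absDiff_self, hF0]
    exact summable_zero
  symm {x y} h := by
    simpa only [Ef, absDiff_comm] using h
  trans {x y z} h h' := by
    refine NNReal.summable_of_le (fun n => ?_) ((h.add h').mul_left ((c ^ 2)⁻¹))
    rw [le_inv_mul_iff₀ (pow_pos hc0 2)]
    -- The larger of the two distances is at least half of `|x n - z n|`, so doubling applies to it.
    have htri := abs_sub_le (x n : ℝ) (y n) (z n)
    rw [← coe_absDiff, ← coe_absDiff, ← coe_absDiff] at htri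
    rcases le_total (absDiff (x n) (y n) : ℝ) (absDiff (y n) (z n)) with hle | hle
    · exact (doubling hF hF0 hc1 hc (by linarith)).trans le_add_self
    · exact (doubling hF hF0 hc1 hc (by linarith)).trans le_self_add

end Doubling

/-! ### Circle coordinates -/

section Wave

/-- The two coordinates of a parametrization of the unit circle. -/
def wave (b : Bool) (x : ℝ) : ℝ := bif b then Real.cos x else Real.sin x

lemma continuous_wave (b : Bool) : Continuous (wave b) := by
  cases b
  · exact Real.continuous_sin
  · exact Real.continuous_cos

lemma abs_wave_sub_le (b : Bool) (x y : ℝ) : |wave b x - wave b y| ≤ |x - y| := by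
  cases b
  · exact Real.abs_sin_sub_sin_le x y
  · exact Real.abs_cos_sub_cos_le x y

lemma abs_wave_sub_le_two (b : Bool) (x y : ℝ) : |wave b x - wave b y| ≤ 2 := by
  cases b
  · have := Real.abs_sin_le_one x
    have := Real.abs_sin_le_one y
    have := abs_sub (Real.sin x) (Real.sin y)
    simp only [wave, cond_false]; linarith
  · have := Real.abs_cos_le_one x
    have := Real.abs_cos_le_one y
    have := abs_sub (Real.cos x) (Real.cos y)
    simp only [wave, cond_true]; linarith

/-- A chord of angle `θ` has length `2 sin(θ/2)`, here at least `1/4` by `sin z ≥ 2z/π`; two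
coordinates below `1/8` would be too short. Sine alone fails near its extrema. -/
lemma exists_le_abs_wave_sub {x y : ℝ} (h1 : 1 / 2 ≤ |x - y|) (h2 : |x - y| ≤ 1) :
    ∃ b, 1 / 8 ≤ |wave b x - wave b y| := by
  by_contra! h
  have hs := h false
  have hc := h true
  simp only [wave, cond_false, cond_true] at hs hc
  have hs2 := sq_lt_sq' (neg_lt_of_abs_lt hs) (lt_of_abs_lt hs)
  have hc2 := sq_lt_sq' (neg_lt_of_abs_lt hc) (lt_of_abs_lt hc)
  have hkey : (Real.cos x - Real.cos y) ^ 2 + (Real.sin x - Real.sin y) ^ 2 =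
      4 * Real.sin (|x - y| / 2) ^ 2 := by
    have e1 : Real.sin (|x - y| / 2) ^ 2 = 1 / 2 - Real.cos (x - y) / 2 := by
      rw [Real.sin_sq_eq_half_sub, mul_div_cancel₀ _ two_ne_zero, Real.cos_abs]
    rw [e1, Real.cos_sub]
    linear_combination Real.sin_sq_add_cos_sq x + Real.sin_sq_add_cos_sq y
  have hsin : 1 / 8 ≤ Real.sin (|x - y| / 2) := by
    have h3 : 2 / Real.pi * (|x - y| / 2) ≤ Real.sin (|x - y| / 2) :=
      Real.mul_le_sin (by positivity) (by linarith [Real.pi_gt_three])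
    have h4 : 1 / 8 ≤ 2 / Real.pi * (|x - y| / 2) := by
      rw [div_mul_eq_mul_div, le_div_iff₀ Real.pi_pos]
      linarith [Real.pi_le_four]
    exact h4.trans h3
  have hsin2 := pow_le_pow_left₀ (by norm_num) hsin 2
  linarith

end Wave

/-- Indexing by the distance `j` to `N`, each of the two sides uses every `H j` at most once. -/
lemma tsum_le_two_mul_tsum {G H : ℕ → ℝ≥0∞} (N : ℕ) (h1 : ∀ n j, n + j = N → G n ≤ H j)
    (h2 : ∀ j, G (N + j) ≤ H j) : ∑' n, G n ≤ 2 * ∑' j, H j := by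
  have hG : Summable fun i => G (i + N) := ENNReal.summable
  rw [← hG.sum_add_tsum_nat_add', two_mul]
  refine add_le_add ?_ (ENNReal.tsum_le_tsum fun i => add_comm N i ▸ h2 i)
  calc ∑ n ∈ Finset.range N, G n ≤ ∑ n ∈ Finset.range N, H (N - 1 - n + 1) := by
        refine Finset.sum_le_sum fun n hn => h1 _ _ ?_
        have := Finset.mem_range.1 hn
        omega
    _ = ∑ j ∈ Finset.range N, H (j + 1) := Finset.sum_range_reflect (fun j => H (j + 1)) N
    _ ≤ ∑' j, H (j + 1) := ENNReal.sum_le_tsum _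
    _ ≤ ∑' j, H j := ENNReal.tsum_comp_le_tsum_of_injective (add_left_injective 1) H

lemma lpRel_iff {p : ℝ} (hp : 1 ≤ p) (x y : ℕ → ℝ) :
    lpRel p x y ↔ ∑' n, ENNReal.ofReal (|x n - y n| ^ p) ≠ ∞ := by
  have h0 : 0 ≤ p := by linarith
  rw [lpRel, memℓp_gen_iff (by rw [ENNReal.toReal_ofReal h0]; linarith),
    ENNReal.toReal_ofReal h0]
  simp only [Pi.sub_apply, Real.norm_eq_abs]
  refine ⟨fun h => h.tsum_ofReal_ne_top, fun h => ?_⟩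
  refine (ENNReal.summable_toReal h).congr fun n => ?_
  rw [ENNReal.toReal_ofReal (by positivity)]

/-! ### Reduction to `ℓ_β` -/

section ToLp

variable {F : I → ℝ≥0} {c : ℝ≥0} {β : ℝ}

/-- The coordinates of an embedding of `[0,1]` into `ℓ_β` which transforms the `β`-th power of the
distance into `F` of the distance, up to constants. -/
def waveEmb (F : I → ℝ≥0) (β : ℝ) (q : ℕ × Bool) (x : I) : ℝ :=
  (F (dyadic q.1) : ℝ) ^ β⁻¹ * wave q.2 (2 ^ q.1 * x)

lemma abs_waveEmb_sub_rpow (hβ : 1 ≤ β) (q : ℕ × Bool) (x y : I) :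
    |waveEmb F β q x - waveEmb F β q y| ^ β =
      F (dyadic q.1) * |wave q.2 (2 ^ q.1 * x) - wave q.2 (2 ^ q.1 * y)| ^ β := by
  have hF : (0 : ℝ) ≤ (F (dyadic q.1) : ℝ) ^ β⁻¹ := by positivity
  rw [waveEmb, waveEmb, ← mul_sub, abs_mul, Real.mul_rpow (abs_nonneg _) (abs_nonneg _),
    abs_of_nonneg hF, Real.rpow_inv_rpow (NNReal.coe_nonneg _) (by linarith)]

lemma abs_two_pow_mul_sub (n : ℕ) (x y : I) :
    |(2 : ℝ) ^ n * x - 2 ^ n * y| = 2 ^ n * absDiff x y := by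
  rw [← mul_sub, abs_mul, coe_absDiff, abs_of_nonneg (by positivity)]

lemma le_tsum_waveEmb (hF : Monotone F) (hF0 : F 0 = 0) (hβ : 1 ≤ β) (x y : I) :
    ENNReal.ofReal ((1 / 8) ^ β) * F (absDiff x y) ≤
      ∑' q, ENNReal.ofReal (|waveEmb F β q x - waveEmb F β q y| ^ β) := by
  rcases (absDiff x y).2.1.eq_or_lt with ht | ht
  · have : absDiff x y = 0 := by ext; exact ht.symm
    simp [this, hF0]
  obtain ⟨N, h1, h2⟩ := exists_dyadic_lt_le ht
  rw [← Subtype.coe_lt_coe, coe_dyadic] at h1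
  have h2' := Subtype.coe_le_coe.2 h2
  rw [coe_dyadic] at h2'
  have hp : (2 : ℝ) ^ N * (1 / 2) ^ N = 1 := by rw [← mul_pow]; norm_num
  have hpos : (0 : ℝ) < 2 ^ N := by positivity
  obtain ⟨b, hb⟩ := exists_le_abs_wave_sub (x := 2 ^ N * (x : ℝ)) (y := 2 ^ N * (y : ℝ))
    (by rw [abs_two_pow_mul_sub]; rw [pow_succ] at h1; nlinarith)
    (by rw [abs_two_pow_mul_sub]; nlinarith)
  refine le_trans ?_ (ENNReal.le_tsum (N, b))
  rw [abs_waveEmb_sub_rpow hβ, ENNReal.ofReal_mul (NNReal.coe_nonneg _), ENNReal.ofReal_coe_nnreal,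
    mul_comm]
  have h3 : F (absDiff x y) ≤ F (dyadic N) := hF h2
  gcongr

/-- Coarse frequencies use the Lipschitz bound and `h1`, fine ones the trivial bound `2` and `h2`.
The `4` counts two sides times two waves; `c⁻¹` passes from `F (dyadic N)` to `F (absDiff x y)`. -/
lemma tsum_waveEmb_le (hF : Monotone F) (hc0 : 0 < c)
    (hc : ∀ n, c * F (dyadic n) ≤ F (dyadic (n + 1))) (hβ : 1 ≤ β) {H : ℕ → ℝ}
    (hH0 : ∀ j, 0 ≤ H j)
    (h1 : ∀ n j, F (dyadic n) * ((1 / 2 : ℝ) ^ β) ^ j ≤ H j * F (dyadic (n + j)))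
    (h2 : ∀ n j, (F (dyadic (n + j)) : ℝ) ≤ H j * F (dyadic n)) (x y : I) :
    ∑' q, ENNReal.ofReal (|waveEmb F β q x - waveEmb F β q y| ^ β) ≤
      (4 * (c⁻¹ : ℝ≥0) * ENNReal.ofReal (2 ^ β) * ∑' j, ENNReal.ofReal (H j)) *
        F (absDiff x y) := by
  have hβ0 : 0 ≤ β := by linarith
  rcases (absDiff x y).2.1.eq_or_lt with ht | ht
  · have hxy : x = y := by
      rw [coe_absDiff] at ht
      ext
      linarith [abs_eq_zero.1 ht.symm]
    have hβ' : β ≠ 0 := by linarith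
    simp [hxy, Real.zero_rpow hβ']
  obtain ⟨N, hN1, hN2⟩ := exists_dyadic_lt_le ht
  have hN2' := Subtype.coe_le_coe.2 hN2
  rw [coe_dyadic] at hN2'
  have hFN : F (dyadic N) ≤ c⁻¹ * F (absDiff x y) := by
    rw [le_inv_mul_iff₀ hc0]
    exact (hc N).trans (hF hN1.le)
  have hterm : ∀ b : Bool, ∑' n, ENNReal.ofReal
      (|waveEmb F β (n, b) x - waveEmb F β (n, b) y| ^ β) ≤
      2 * ∑' j, ENNReal.ofReal (2 ^ β * F (dyadic N)) * ENNReal.ofReal (H j) := by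
    intro b
    have h2β : (1 : ℝ) ≤ 2 ^ β := Real.one_le_rpow one_le_two hβ0
    refine tsum_le_two_mul_tsum N (fun n j hnj => ?_) fun j => ?_
    · rw [← ENNReal.ofReal_mul (by positivity), abs_waveEmb_sub_rpow hβ]
      refine ENNReal.ofReal_le_ofReal ?_
      have hle : |wave b (2 ^ n * x) - wave b (2 ^ n * y)| ≤ (1 / 2) ^ j := by
        refine (abs_wave_sub_le _ _ _).trans ?_
        rw [abs_two_pow_mul_sub]
        calc (2 : ℝ) ^ n * absDiff x y ≤ 2 ^ n * (1 / 2) ^ N := by gcongr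
          _ = (1 / 2) ^ j := by
            rw [← hnj, pow_add, ← mul_assoc, ← mul_pow]; norm_num
      calc F (dyadic n) * |wave b (2 ^ n * x) - wave b (2 ^ n * y)| ^ β
          ≤ F (dyadic n) * ((1 / 2) ^ j) ^ β := by gcongr
        _ = F (dyadic n) * ((1 / 2 : ℝ) ^ β) ^ j := by
          rw [Real.rpow_pow_comm (by norm_num)]
        _ ≤ H j * F (dyadic N) := hnj ▸ h1 n j
        _ ≤ 2 ^ β * (H j * F (dyadic N)) :=
          le_mul_of_one_le_left (mul_nonneg (hH0 j) (NNReal.coe_nonneg _)) h2β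
        _ = _ := by ring
    · rw [← ENNReal.ofReal_mul (by positivity), abs_waveEmb_sub_rpow hβ]
      refine ENNReal.ofReal_le_ofReal ?_
      calc F (dyadic (N + j)) * |wave b (2 ^ (N + j) * x) - wave b (2 ^ (N + j) * y)| ^ β
          ≤ (H j * F (dyadic N)) * 2 ^ β := by
            gcongr
            · exact mul_nonneg (hH0 j) (NNReal.coe_nonneg _)
            · exact h2 N j
            · exact abs_wave_sub_le_two _ _ _
        _ = _ := by ring
  rw [ENNReal.tsum_prod (f := fun n b =>
    ENNReal.ofReal (|waveEmb F β (n, b) x - waveEmb F β (n, b) y| ^ β)), ENNReal.tsum_comm,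
    tsum_bool]
  refine (add_le_add (hterm _) (hterm _)).trans ?_
  rw [ENNReal.tsum_mul_left, ENNReal.ofReal_mul (by positivity), ENNReal.ofReal_coe_nnreal]
  calc _ = (4 * ENNReal.ofReal (2 ^ β) * ∑' j, ENNReal.ofReal (H j)) * F (dyadic N) := by ring
    _ ≤ (4 * ENNReal.ofReal (2 ^ β) * ∑' j, ENNReal.ofReal (H j)) *
        ((c⁻¹ : ℝ≥0) * F (absDiff x y)) := by
      refine mul_le_mul' le_rfl ?_
      exact_mod_cast hFN
    _ = _ := by ring

/-- `E_F` is reducible to `ℝ^ω / ℓ_β` when `F` grows regularly enough and is dominated, in a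
summable way, by the power `β`. -/
theorem borelReducible_Ef_lpRel (hF : Monotone F) (hF0 : F 0 = 0) (hc0 : 0 < c)
    (hc : ∀ n, c * F (dyadic n) ≤ F (dyadic (n + 1))) (hβ : 1 ≤ β) {H : ℕ → ℝ}
    (hH0 : ∀ j, 0 ≤ H j) (hH : Summable H)
    (h1 : ∀ n j, F (dyadic n) * ((1 / 2 : ℝ) ^ β) ^ j ≤ H j * F (dyadic (n + j)))
    (h2 : ∀ n j, (F (dyadic (n + j)) : ℝ) ≤ H j * F (dyadic n)) :
    BorelReducible (Ef F) (lpRel β) := by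
  obtain ⟨e⟩ : Nonempty (ℕ ≃ ℕ × ℕ × Bool) := nonempty_equiv_of_countable
  refine ⟨fun x n => waveEmb F β (e n).2 (x (e n).1), ?_, fun x y => ?_⟩
  · refine measurable_pi_iff.2 fun n => Continuous.measurable ?_
    have := continuous_wave (e n).2.2
    unfold waveEmb
    fun_prop
  rw [lpRel_iff hβ, Ef, ← ENNReal.tsum_coe_ne_top_iff_summable,
    e.tsum_eq fun q => ENNReal.ofReal (|waveEmb F β q.2 (x q.1) - waveEmb F β q.2 (y q.1)| ^ β),
    ENNReal.tsum_prod (f := fun i q =>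
      ENNReal.ofReal (|waveEmb F β q (x i) - waveEmb F β q (y i)| ^ β))]
  constructor
  · intro h
    refine ne_top_of_le_ne_top ?_ (ENNReal.tsum_le_tsum fun i =>
      tsum_waveEmb_le hF hc0 hc hβ hH0 h1 h2 (x i) (y i))
    rw [ENNReal.tsum_mul_left]
    refine ENNReal.mul_ne_top (ENNReal.mul_ne_top (ENNReal.mul_ne_top (ENNReal.mul_ne_top ?_ ?_)
      ENNReal.ofReal_ne_top) hH.tsum_ofReal_ne_top) h
    · norm_num
    · exact ENNReal.coe_ne_top
  · intro h h'
    refine h (top_le_iff.1 ?_)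
    calc ∞ = ENNReal.ofReal ((1 / 8) ^ β) * ∑' i, (F (absDiff (x i) (y i)) : ℝ≥0∞) := by
          rw [h', ENNReal.mul_top]
          rw [Ne, ENNReal.ofReal_eq_zero, not_le]
          positivity
      _ = ∑' i, ENNReal.ofReal ((1 / 8) ^ β) * (F (absDiff (x i) (y i)) : ℝ≥0∞) :=
          ENNReal.tsum_mul_left.symm
      _ ≤ _ := ENNReal.tsum_le_tsum fun i => le_tsum_waveEmb hF hF0 hβ (x i) (y i)

end ToLp

/-! ### Spreading the line over unit intervals -/

section Clamp

/-- The nearest point projection of `ℝ` onto `[0,1]`. -/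
def clamp (t : ℝ) : I := Set.projIcc 0 1 zero_le_one t

lemma coe_clamp (t : ℝ) : (clamp t : ℝ) = max 0 (min 1 t) := Set.coe_projIcc 0 1 zero_le_one t

lemma continuous_clamp : Continuous clamp :=
  continuous_projIcc (h := zero_le_one)

/-- The distance of the `j`-th coordinates of `s` and `t` in the embedding of `ℝ` into `[0,1]^ℤ`
that sends `t` to `j ↦ clamp (t - j)`. -/
def clampDiff (s t : ℝ) (j : ℤ) : I := absDiff (clamp (s - j)) (clamp (t - j))

lemma clampDiff_comm (s t : ℝ) : clampDiff s t = clampDiff t s :=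
  funext fun _ => absDiff_comm _ _

lemma clampDiff_le (s t : ℝ) (j : ℤ) : (clampDiff s t j : ℝ) ≤ |s - t| := by
  rw [clampDiff, coe_absDiff]
  have h := (LipschitzWith.projIcc (zero_le_one (α := ℝ))).dist_le_mul (s - j) (t - j)
  rw [Subtype.dist_eq, Real.dist_eq, Real.dist_eq, NNReal.coe_one, one_mul,
    sub_sub_sub_cancel_right] at h
  exact h

lemma clampDiff_eq_zero {s t : ℝ} (hst : s ≤ t) {j : ℤ} (hj : j ∉ Finset.Icc ⌊s⌋ ⌈t⌉) :
    clampDiff s t j = 0 := by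
  rw [clampDiff]
  suffices h : clamp (s - j) = clamp (t - j) by rw [h, absDiff_self]
  rw [Finset.mem_Icc, not_and_or, not_le, not_le] at hj
  rcases hj with hj | hj
  · have h1 : ((j + 1 : ℤ) : ℝ) ≤ s := Int.le_floor.1 hj
    push_cast at h1
    rw [clamp, clamp, Set.projIcc_of_right_le _ (by linarith),
      Set.projIcc_of_right_le _ (by linarith)]
  · have h1 : t < j := (Int.le_ceil t).trans_lt (Int.cast_lt.2 hj)
    rw [clamp, clamp, Set.projIcc_of_le_left _ (by linarith),
      Set.projIcc_of_le_left _ (by linarith)]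

/-- For `s ≤ t`, the cells `⌊s⌋` and `⌊s⌋ + 1` cover `[s, s + 1]`, so their increments sum to at
least `min 1 |s - t|`, and one is at least half of it. -/
lemma exists_le_clampDiff (s t : ℝ) : ∃ j, min 1 |s - t| / 2 ≤ clampDiff s t j := by
  wlog hst : s ≤ t generalizing s t
  · rw [clampDiff_comm, abs_sub_comm]
    exact this t s (le_of_not_ge hst)
  by_contra! h
  have h0 := h ⌊s⌋
  have h1 := h (⌊s⌋ + 1)
  have hs0 := Int.floor_le s
  have hs1 := Int.lt_floor_add_one s
  rw [clampDiff, coe_absDiff, coe_clamp, coe_clamp, abs_sub_comm] at h0 h1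
  replace h0 := lt_of_abs_lt h0
  replace h1 := lt_of_abs_lt h1
  push_cast at h1
  rw [abs_sub_comm s t, abs_of_nonneg (sub_nonneg.2 hst)] at h0 h1
  have e0 : max 0 (min 1 (s - ⌊s⌋)) = s - ⌊s⌋ := by
    rw [min_eq_right (by linarith), max_eq_right (by linarith)]
  have e1 : max 0 (min 1 (s - (⌊s⌋ + 1))) = 0 := by
    rw [min_eq_right (by linarith), max_eq_left (by linarith)]
  rw [e0] at h0
  rw [e1] at h1
  have l0 := le_max_right 0 (min 1 (t - ⌊s⌋))
  have l1 := le_max_right 0 (min 1 (t - (⌊s⌋ + 1)))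
  have l2 := le_max_left 0 (min 1 (t - (⌊s⌋ + 1)))
  have l3 := min_le_left 1 (t - s)
  have l4 := min_le_right 1 (t - s)
  rcases min_cases 1 (t - ⌊s⌋) with ⟨h2, h2'⟩ | ⟨h2, h2'⟩ <;>
  rcases min_cases 1 (t - (⌊s⌋ + 1)) with ⟨h3, h3'⟩ | ⟨h3, h3'⟩ <;> linarith

variable {α : ℝ}

/-- The `α`-th power of the `ℓ_α` distance of the images of `s` and `t` in `[0,1]^ℤ`. -/
def clampSum (α s t : ℝ) : ℝ≥0∞ := ∑' j, ENNReal.ofReal ((clampDiff s t j : ℝ) ^ α)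

lemma le_clampSum (hα : 1 ≤ α) (s t : ℝ) :
    ENNReal.ofReal ((min 1 |s - t| / 2) ^ α) ≤ clampSum α s t := by
  obtain ⟨j, hj⟩ := exists_le_clampDiff s t
  refine le_trans (ENNReal.ofReal_le_ofReal ?_) (ENNReal.le_tsum j)
  exact Real.rpow_le_rpow (by positivity) hj (by linarith)

lemma clampSum_le (hα : 1 ≤ α) (s t : ℝ) :
    clampSum α s t ≤ ENNReal.ofReal ((|s - t| + 3) * |s - t| ^ α) := by
  wlog hst : s ≤ t generalizing s t
  · rw [clampSum, clampDiff_comm, abs_sub_comm]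
    exact this t s (le_of_not_ge hst)
  rw [clampSum, tsum_eq_sum (s := Finset.Icc ⌊s⌋ ⌈t⌉)]
  · refine (Finset.sum_le_card_nsmul _ _ (ENNReal.ofReal (|s - t| ^ α)) fun j _ => ?_).trans ?_
    · exact ENNReal.ofReal_le_ofReal
        (Real.rpow_le_rpow (clampDiff s t j).2.1 (clampDiff_le s t j) (by linarith))
    · rw [nsmul_eq_mul, ENNReal.ofReal_mul (by positivity), ← ENNReal.ofReal_natCast]
      gcongr
      have h1 : ⌊s⌋ ≤ ⌈t⌉ + 1 := by
        have := (Int.floor_le_ceil s).trans (Int.ceil_mono hst)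
        omega
      have h2 : ((Finset.Icc ⌊s⌋ ⌈t⌉).card : ℤ) = ⌈t⌉ + 1 - ⌊s⌋ := by
        rw [Int.card_Icc, Int.toNat_of_nonneg (by omega)]
      have h3 : ((Finset.Icc ⌊s⌋ ⌈t⌉).card : ℝ) = ⌈t⌉ + 1 - ⌊s⌋ := by exact_mod_cast h2
      rw [h3, abs_sub_comm]
      linarith [le_abs_self (t - s), Int.ceil_lt_add_one t, Int.lt_floor_add_one s]
  · intro j hj
    have hα0 : α ≠ 0 := by linarith
    simp [clampDiff_eq_zero hst hj, Real.zero_rpow hα0]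

/-- `clampSum α s t` is comparable to `|s - t|^α` while `|s - t|` stays bounded; convergence of
either sum ensures this. -/
lemma tsum_clampSum_ne_top_iff (hα : 1 ≤ α) (x y : ℕ → ℝ) :
    ∑' i, clampSum α (x i) (y i) ≠ ∞ ↔ lpRel α x y := by
  have hα0 : 0 < α := by linarith
  rw [lpRel_iff hα]
  constructor
  · intro h
    have h1 : ∑' i, ENNReal.ofReal ((min 1 |x i - y i| / 2) ^ α) ≠ ∞ :=
      ne_top_of_le_ne_top h (ENNReal.tsum_le_tsum fun i => le_clampSum hα _ _)
    have h2 : Summable fun i => (min 1 |x i - y i| / 2) ^ α := by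
      refine (ENNReal.summable_toReal h1).congr fun i => ?_
      rw [ENNReal.toReal_ofReal (by positivity)]
    refine Summable.tsum_ofReal_ne_top
      (Summable.of_norm_bounded_eventually_nat (h2.mul_left (2 ^ α)) ?_)
    have h3 : (0 : ℝ) < (1 / 2) ^ α := by positivity
    -- The terms tend to `0`, so the truncation at `1` is eventually inactive.
    filter_upwards [h2.tendsto_atTop_zero.eventually_lt_const h3] with i hi
    have hi' : min 1 |x i - y i| < 1 := by
      have := (Real.rpow_lt_rpow_iff (by positivity) (by norm_num) hα0).1 hi
      linarith
    have h4 : min 1 |x i - y i| = |x i - y i| := by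
      rcases min_choice 1 |x i - y i| with h | h
      · exact absurd h hi'.ne
      · exact h
    rw [h4, ← Real.mul_rpow (by norm_num) (by positivity), mul_div_cancel₀ _ two_ne_zero,
      Real.norm_of_nonneg (by positivity)]
  · intro h
    have hb : ∀ i, |x i - y i| ≤ (∑' i, ENNReal.ofReal (|x i - y i| ^ α)).toReal ^ α⁻¹ := by
      intro i
      rw [Real.le_rpow_inv_iff_of_pos (abs_nonneg _) ENNReal.toReal_nonneg hα0]
      exact (ENNReal.ofReal_le_iff_le_toReal h).1
        (ENNReal.le_tsum (f := fun i => ENNReal.ofReal (|x i - y i| ^ α)) i)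
    set B := (∑' i, ENNReal.ofReal (|x i - y i| ^ α)).toReal ^ α⁻¹
    have hB : 0 ≤ B := (abs_nonneg _).trans (hb 0)
    have h1 : ∀ i, clampSum α (x i) (y i) ≤
        ENNReal.ofReal (B + 3) * ENNReal.ofReal (|x i - y i| ^ α) := by
      intro i
      refine (clampSum_le hα _ _).trans ?_
      rw [← ENNReal.ofReal_mul (by positivity)]
      refine ENNReal.ofReal_le_ofReal ?_
      have := hb i
      gcongr
    refine ne_top_of_le_ne_top ?_ (ENNReal.tsum_le_tsum h1)
    rw [ENNReal.tsum_mul_left]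
    exact ENNReal.mul_ne_top ENNReal.ofReal_ne_top h

end Clamp

/-! ### Rounding to dyadic grids -/

section Grid

/-- Rounding down to a multiple of `2^{-i}`. -/
def gridFloor (i : ℕ) (t : ℝ) : ℝ := ⌊2 ^ i * t⌋ / 2 ^ i

lemma measurable_gridFloor (i : ℕ) : Measurable (gridFloor i) := by
  unfold gridFloor
  have h : Measurable fun t : ℝ => ⌊2 ^ i * t⌋ := (measurable_const.mul measurable_id).floor
  exact ((measurable_of_countable fun z : ℤ => (z : ℝ)).comp h).div_const _

lemma abs_sub_gridFloor_le (i : ℕ) (t : ℝ) : |t - gridFloor i t| ≤ (1 / 2) ^ i := by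
  have hp : (0 : ℝ) < 2 ^ i := by positivity
  have h1 := Int.floor_le (2 ^ i * t)
  have h2 := Int.lt_floor_add_one (2 ^ i * t)
  rw [gridFloor, one_div_pow, abs_le]
  constructor
  · rw [le_sub_iff_add_le, ← sub_eq_neg_add, ← sub_div, div_le_iff₀ hp]
    linarith
  · rw [sub_le_iff_le_add, ← add_div, le_div_iff₀ hp]
    linarith

lemma lpRel_gridFloor {α : ℝ} (hα : 1 ≤ α) (x : ℕ → ℝ) :
    lpRel α x (fun i => gridFloor i (x i)) := by
  rw [lpRel_iff hα]
  refine Summable.tsum_ofReal_ne_top (Summable.of_nonneg_of_le (fun i => by positivity)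
    (fun i => ?_) summable_geometric_two)
  have h := abs_sub_gridFloor_le i (x i)
  have h1 : ((1 : ℝ) / 2) ^ i ≤ 1 := pow_le_one₀ (by norm_num) (by norm_num)
  rcases (abs_nonneg (x i - gridFloor i (x i))).eq_or_lt with h0 | h0
  · rw [← h0, Real.zero_rpow (by linarith)]
    positivity
  · calc _ ≤ |x i - gridFloor i (x i)| ^ (1 : ℝ) :=
          Real.rpow_le_rpow_of_exponent_ge h0 (h.trans h1) hα
      _ ≤ _ := by rwa [Real.rpow_one]

lemma lpRel_gridFloor_iff {α : ℝ} (hα : 1 ≤ α) (x y : ℕ → ℝ) :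
    lpRel α (fun i => gridFloor i (x i)) (fun i => gridFloor i (y i)) ↔ lpRel α x y := by
  have hx := lpRel_gridFloor hα x
  have hy := lpRel_gridFloor hα y
  unfold lpRel at *
  constructor
  · intro h
    convert (hx.add h).sub hy using 1
    abel
  · intro h
    convert (h.sub hx).add hy using 1
    abel

lemma exists_int_clamp_eq (i : ℕ) (t : ℝ) (j : ℤ) :
    ∃ z : ℤ, (clamp (gridFloor i t - j) : ℝ) = z / 2 ^ i := by
  have hp : (2 : ℝ) ^ i ≠ 0 := by positivity
  rw [coe_clamp]
  rcases max_choice 0 (min 1 (gridFloor i t - j)) with h | h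
  · exact ⟨0, by rw [h]; simp⟩
  · rw [h]
    rcases min_choice 1 (gridFloor i t - j) with h | h
    · exact ⟨2 ^ i, by rw [h]; push_cast; rw [div_self hp]⟩
    · refine ⟨⌊2 ^ i * t⌋ - j * 2 ^ i, ?_⟩
      rw [h, gridFloor]
      push_cast
      rw [sub_div, mul_div_cancel_right₀ _ hp]

/-- Clamping preserves `2^{-i}ℤ`, as `0` and `1` belong to it, so distinct values differ by at least
one grid step. -/
lemma clampDiff_gridFloor (i : ℕ) (s t : ℝ) (j : ℤ) :
    clampDiff (gridFloor i s) (gridFloor i t) j = 0 ∨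
      (1 / 2) ^ i ≤ (clampDiff (gridFloor i s) (gridFloor i t) j : ℝ) := by
  obtain ⟨z, hz⟩ := exists_int_clamp_eq i s j
  obtain ⟨w, hw⟩ := exists_int_clamp_eq i t j
  have hp : (0 : ℝ) < 2 ^ i := by positivity
  rcases eq_or_ne z w with rfl | hne
  · left
    rw [clampDiff, Subtype.ext (hz.trans hw.symm), absDiff_self]
  · right
    rw [clampDiff, coe_absDiff, hz, hw, ← sub_div, abs_div, abs_of_pos hp, one_div_pow]
    gcongr
    have : 1 ≤ |z - w| := Int.one_le_abs (sub_ne_zero.2 hne)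
    exact_mod_cast this

end Grid

/-! ### Reduction from `ℓ_α` -/

section FromLp

lemma absDiff_mul (c x y : I) : absDiff (c * x) (c * y) = c * absDiff x y := by
  ext
  rw [coe_absDiff, Set.Icc.coe_mul, Set.Icc.coe_mul, Set.Icc.coe_mul, coe_absDiff, ← mul_sub,
    abs_mul, abs_of_nonneg c.2.1]

/-- `ℝ^ω / ℓ_α` is reducible to `E_F` when `F` agrees with a multiple of the `α`-th power on
intervals `[2^{-i} c, c]` for every `i`. -/
theorem borelReducible_lpRel_Ef {F : I → ℝ≥0} (hF0 : F 0 = 0) {α : ℝ} (hα : 1 ≤ α)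
    (hF : ∀ i : ℕ, ∃ c : I, ∃ v : ℝ, 0 < v ∧ v ≤ 1 ∧
      ∀ r : I, r = 0 ∨ (1 / 2) ^ i ≤ (r : ℝ) → (F (c * r) : ℝ) = v * (r : ℝ) ^ α) :
    BorelReducible (lpRel α) (Ef F) := by
  choose c v hv0 hv1 hcv using hF
  obtain ⟨e⟩ : Nonempty (ℕ ≃ ℕ × ℤ × ℕ) := nonempty_equiv_of_countable
  -- The second index counts `⌈1/v⌉` copies, of total weight `⌈1/v⌉ v` in `[1, 2]`; the remaining
  -- coordinates are constant and contribute `F 0 = 0`.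
  let K : ℕ → ℤ × ℕ → ℝ → I := fun i q t =>
    if q.2 < ⌈(v i)⁻¹⌉₊ then c i * clamp (gridFloor i t - q.1) else 0
  have hK : ∀ i q, Measurable (K i q) := by
    intro i q
    refine Measurable.ite (MeasurableSet.const _) ?_ measurable_const
    exact ((continuous_const.mul continuous_clamp).measurable).comp
      ((measurable_gridFloor i).sub_const _)
  have hsum : ∀ i s t, ∑' q, (F (absDiff (K i q s) (K i q t)) : ℝ≥0∞) =
      ENNReal.ofReal (⌈(v i)⁻¹⌉₊ * v i) * clampSum α (gridFloor i s) (gridFloor i t) := by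
    intro i s t
    rw [ENNReal.tsum_prod (f := fun j n => (F (absDiff (K i (j, n) s) (K i (j, n) t)) : ℝ≥0∞)),
      clampSum, ← ENNReal.tsum_mul_left]
    refine tsum_congr fun j => ?_
    rw [tsum_eq_sum (s := Finset.range ⌈(v i)⁻¹⌉₊)]
    · rw [Finset.sum_congr rfl (g := fun _ => ENNReal.ofReal
        (v i * (clampDiff (gridFloor i s) (gridFloor i t) j : ℝ) ^ α))]
      · rw [Finset.sum_const, Finset.card_range, nsmul_eq_mul,
          ENNReal.ofReal_mul (hv0 i).le, ENNReal.ofReal_mul (Nat.cast_nonneg _),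
          ENNReal.ofReal_natCast, mul_assoc]
      · intro n hn
        simp only [K, if_pos (Finset.mem_range.1 hn)]
        rw [absDiff_mul, ← clampDiff, ← hcv i _ (clampDiff_gridFloor i s t j),
          ENNReal.ofReal_coe_nnreal]
    · intro n hn
      simp only [K, if_neg (mt Finset.mem_range.2 hn), absDiff_self, hF0, ENNReal.coe_zero]
  have hlow : ∀ i, 1 ≤ ENNReal.ofReal (⌈(v i)⁻¹⌉₊ * v i) := by
    intro i
    rw [ENNReal.one_le_ofReal]
    calc (1 : ℝ) = (v i)⁻¹ * v i := (inv_mul_cancel₀ (hv0 i).ne').symm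
      _ ≤ _ := mul_le_mul_of_nonneg_right (Nat.le_ceil _) (hv0 i).le
  have hupp : ∀ i, ENNReal.ofReal (⌈(v i)⁻¹⌉₊ * v i) ≤ 2 := by
    intro i
    rw [← ENNReal.ofReal_ofNat]
    refine ENNReal.ofReal_le_ofReal ?_
    calc _ ≤ ((v i)⁻¹ + 1) * v i :=
          mul_le_mul_of_nonneg_right (Nat.ceil_lt_add_one (inv_pos.2 (hv0 i)).le).le (hv0 i).le
      _ = 1 + v i := by rw [add_mul, inv_mul_cancel₀ (hv0 i).ne', one_mul]
      _ ≤ 2 := by linarith [hv1 i]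
  refine ⟨fun x n => K (e n).1 (e n).2 (x (e n).1), ?_, fun x y => ?_⟩
  · exact measurable_pi_iff.2 fun n => (hK _ _).comp (measurable_pi_apply _)
  rw [← lpRel_gridFloor_iff hα, ← tsum_clampSum_ne_top_iff hα, Ef,
    ← ENNReal.tsum_coe_ne_top_iff_summable,
    e.tsum_eq fun q => (F (absDiff (K q.1 q.2 (x q.1)) (K q.1 q.2 (y q.1))) : ℝ≥0∞),
    ENNReal.tsum_prod (f := fun i q => (F (absDiff (K i q (x i)) (K i q (y i))) : ℝ≥0∞))]
  simp only [hsum]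
  constructor
  · intro h
    refine ne_top_of_le_ne_top (ENNReal.mul_ne_top (ENNReal.ofNat_ne_top (n := 2)) h) ?_
    rw [← ENNReal.tsum_mul_left]
    exact ENNReal.tsum_le_tsum fun i => mul_le_mul' (hupp i) le_rfl
  · exact fun h => ne_top_of_le_ne_top h
      (ENNReal.tsum_le_tsum fun i => le_mul_of_one_le_left' (hlow i))

end FromLp

/-! ### The function `x^α φ(x)` at dyadic scales -/

section PowMul

variable {α : ℝ} {φ : I → ℝ≥0} {u : ℕ → ℝ}

lemma coe_powMul (x : I) : (powMul α φ x : ℝ) = (x : ℝ) ^ α * φ x := by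
  simp [powMul]

lemma powMul_monotone (hα : 0 ≤ α) (hφ : Monotone φ) : Monotone (powMul α φ) := fun _ _ hxy =>
  mul_le_mul' (NNReal.rpow_le_rpow hxy hα) (hφ hxy)

lemma powMul_zero (hα : α ≠ 0) : powMul α φ 0 = 0 := by
  simp [powMul, hα]

lemma powMul_dyadic (hu : ∀ n, (φ (dyadic n) : ℝ) = u n) (n : ℕ) :
    (powMul α φ (dyadic n) : ℝ) = ((1 / 2 : ℝ) ^ α) ^ n * u n := by
  rw [coe_powMul, hu, coe_dyadic, Real.rpow_pow_comm (by norm_num)]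

/-- A monotone `φ` with equal values at `2^{-n-i}` and `2^{-n}` is constant in between. -/
lemma powMul_dyadic_mul (hφ : Monotone φ) (hu : ∀ n, (φ (dyadic n) : ℝ) = u n) {n i : ℕ}
    (hni : u (n + i) = u n) {r : I} (hr : (1 / 2) ^ i ≤ (r : ℝ)) :
    (powMul α φ (dyadic n * r) : ℝ) = ((1 / 2 : ℝ) ^ α) ^ n * u n * (r : ℝ) ^ α := by
  have h1 : φ (dyadic n * r) ≤ φ (dyadic n) := by
    refine hφ ?_
    rw [← Subtype.coe_le_coe, Set.Icc.coe_mul]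
    exact mul_le_of_le_one_right (dyadic n).2.1 r.2.2
  have h2 : φ (dyadic (n + i)) ≤ φ (dyadic n * r) := by
    refine hφ ?_
    rw [← Subtype.coe_le_coe, Set.Icc.coe_mul, coe_dyadic, coe_dyadic, pow_add]
    gcongr
  rw [← NNReal.coe_le_coe, hu] at h1 h2
  rw [coe_powMul, le_antisymm h1 (hni ▸ h2), Set.Icc.coe_mul, coe_dyadic,
    Real.mul_rpow (by positivity) r.2.1, Real.rpow_pow_comm (by norm_num)]
  ring

end PowMul

lemma summable_poly_mul_geometric (L : ℕ) {q : ℝ} (hq0 : 0 < q) (hq1 : q < 1) :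
    Summable fun j : ℕ => (2 * ((j : ℝ) + 1)) ^ L * q ^ j := by
  have h := (summable_nat_add_iff (f := fun n : ℕ => (n : ℝ) ^ L * q ^ n) 1).2
    (summable_pow_mul_geometric_of_norm_lt_one L
      (show ‖q‖ < 1 by rwa [Real.norm_of_nonneg hq0.le]))
  refine (h.mul_left (2 ^ L * q⁻¹)).congr fun j => ?_
  rw [pow_succ q j, mul_pow]
  push_cast
  field_simp

end EfBetween

end


/-! ### Assembly -/

theorem mainTheorem5
    (α : ℝ) (hα : 1 ≤ α)
    (δ : ℕ → ℝ) (hδ : ∀ m, δ m ∈ Set.Ioo (0 : ℝ) 1)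
    (hδ_inf : 0 < ⨅ m, δ m) (hδ_sup : ⨆ m, δ m < 1)
    (k : ℕ → ℕ) (hk_mono : StrictMono k) (hk_two : ∀ m, 2 ≤ k m)
    (hk_double : ∀ m, 2 * k m ≤ k (m + 1))
    (U : Set ℕ)
    (φ : unitInterval → NNReal) (hφ_cont : Continuous φ) (hφ_mono : Monotone φ)
    (hφ : ∀ n : ℕ, (φ (EfBetween.dyadic n) : ℝ) = EfBetween.uSeq δ k U n) :
    Equivalence (EfBetween.Ef (EfBetween.powMul α φ)) ∧
    ∀ β : ℝ, α < β →
      EfBetween.BorelReducible (EfBetween.lpRel α) (EfBetween.Ef (EfBetween.powMul α φ)) ∧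
      EfBetween.BorelReducible (EfBetween.Ef (EfBetween.powMul α φ)) (EfBetween.lpRel β) := by
  open EfBetween in
  have hα0 : 0 < α := by linarith
  set d := ⨅ m, δ m
  have hd : ∀ m, d ≤ δ m := ciInf_le ⟨0, by rintro _ ⟨m, rfl⟩; exact (hδ m).1.le⟩
  have hd1 : d ≤ 1 := (hd 0).trans (hδ 0).2.le
  set u := uSeq δ k U
  have hu0 : ∀ n, 0 < u n := uSeq_pos hδ
  have hu : Antitone u := uSeq_antitone hδ
  set r : ℝ := (1 / 2) ^ α with hr
  have hr0 : 0 < r := by positivity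
  have hr1 : r < 1 := Real.rpow_lt_one (by norm_num) (by norm_num) hα0
  have hF : Monotone (powMul α φ) := powMul_monotone hα0.le hφ_mono
  have hF0 : powMul α φ 0 = 0 := powMul_zero hα0.ne'
  have hdy : ∀ n, (powMul α φ (dyadic n) : ℝ) = r ^ n * u n := powMul_dyadic hφ
  have hrd : 0 < r * d := mul_pos hr0 hδ_inf
  obtain ⟨c, hcrd⟩ : ∃ c : NNReal, (c : ℝ) = r * d := ⟨⟨r * d, hrd.le⟩, rfl⟩
  have hc0 : 0 < c := by rwa [← NNReal.coe_pos, hcrd]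
  have hc1 : c ≤ 1 := by
    rw [← NNReal.coe_le_coe, hcrd]
    exact mul_le_one₀ hr1.le hδ_inf.le hd1
  have hc : ∀ n, c * powMul α φ (dyadic n) ≤ powMul α φ (dyadic (n + 1)) := by
    intro n
    rw [← NNReal.coe_le_coe, NNReal.coe_mul, hcrd, hdy, hdy]
    calc r * d * (r ^ n * u n) = r ^ (n + 1) * (d * u n) := by ring
      _ ≤ r ^ (n + 1) * u (n + 1) := by
        have := mul_uSeq_le_succ (k := k) (U := U) hδ hd1 hd n
        gcongr
  refine ⟨Ef_equivalence hF hF0 hc0 hc1 hc, fun β hβ => ⟨?_, ?_⟩⟩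
  · refine borelReducible_lpRel_Ef hF0 hα fun i => ?_
    obtain ⟨n, hn⟩ := exists_uSeq_const (δ := δ) (U := U) hk_mono hk_double i
    refine ⟨dyadic n, r ^ n * u n, mul_pos (pow_pos hr0 n) (hu0 n), ?_, fun t ht => ?_⟩
    · exact mul_le_one₀ (pow_le_one₀ hr0.le hr1.le) (hu0 n).le (hu (Nat.zero_le n))
    · rcases ht with rfl | ht
      · simp [hF0, hα0.ne']
      · exact powMul_dyadic_mul hφ_mono hφ (hn i le_rfl) ht
  · obtain ⟨L, hL⟩ := exists_uSeq_le_pow_mul (U := U) hδ hδ_inf hd hk_mono hk_two hk_double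
    set s : ℝ := (1 / 2) ^ β
    have hs0 : 0 < s := by positivity
    have hsr : s < r := Real.rpow_lt_rpow_of_exponent_gt (by norm_num) (by norm_num) hβ
    have hpoly := summable_poly_mul_geometric L (div_pos hs0 hr0) ((div_lt_one hr0).2 hsr)
    -- Here `H j = (2(j+1))^L (s/r)^j + r^j`: the first summand serves `h1`, the second `h2`.
    refine borelReducible_Ef_lpRel hF hF0 hc0 hc (hα.trans hβ.le) (fun j => by positivity)
      (hpoly.add (summable_geometric_of_lt_one hr0.le hr1)) (fun n j => ?_) fun n j => ?_
    · rw [hdy, hdy]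
      have hpos := hu0 (n + j)
      calc r ^ n * u n * s ^ j
          ≤ r ^ n * ((2 * ((j : ℝ) + 1)) ^ L * u (n + j)) * s ^ j := by
            have := hL n j
            gcongr
        _ = (2 * ((j : ℝ) + 1)) ^ L * (s / r) ^ j * (r ^ (n + j) * u (n + j)) := by
            rw [div_pow, pow_add]
            field_simp
        _ ≤ _ := by
            refine mul_le_mul_of_nonneg_right ?_ (by positivity)
            exact le_add_of_nonneg_right (by positivity)
    · rw [hdy, hdy]
      have hpos := hu0 n
      calc r ^ (n + j) * u (n + j) ≤ r ^ (n + j) * u n := by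
            have := hu (Nat.le_add_right n j)
            gcongr
        _ = r ^ j * (r ^ n * u n) := by ring
        _ ≤ _ := by
            refine mul_le_mul_of_nonneg_right ?_ (by positivity)
            exact le_add_of_nonneg_left (by positivity)
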